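/- Let $\Omega$ be a standard Borel space and let $\mathscr C$ be a family of Borel subsets of $\Omega$ (a concept class). Write $P_{na}$ for the set of all non-atomic Borel probability measures on $\Omega$, i.e. those $\mu$ for which every Borel set $A$ with $\mu(A)>0$ contains a Borel set $B$ with $0<\mu(B)<\mu(A)$. Measurability of functions and sets on $\Omega^n$ is understood with respect to the completion of the product measure $\mu^{\otimes n}$. Assume that $\mathscr C$ is universally separable: there is a countable $\mathscr C'\subseteq\mathscr C$ such that every $C\in\mathscr C$ is the pointwise limit of a sequence $(C_k)$ in $\mathscr C'$, i.e. for every $x\in\Omega$ one has $x\in C_k\Leftrightarrow x\in C$ for all sufficiently large $k$. Let $\mathrm{VC}(\mathscr C\,\mathrm{mod}\,\omega_1)$ be the supremum of all natural $n$ for which there are uncountable sets $A_1,\dots,A_n\subseteq\Omega$ such that for each $J\subseteq\{1,\dots,n\}$ some $C\in\mathscr C$ contains all $A_i$, $i\in J$, and is disjoint from all $A_i$, $i\notin J$. Suppose that $d=\mathrm{VC}(\mathscr C\,\mathrm{mod}\,\omega_1)<\infty$. Then, in ZFC without additional set-theoretic assumptions, the following hold. 1. $\mathscr C$ is a uniform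 Glivenko–Cantelli class with regard to $P_{na}$: for every $\varepsilon>0$ the sets below are measurable and $$\sup_{\mu\in P_{na}}\mu^{\otimes n}\Bigl\{\sigma\in\Omega^n:\ \sup_{C\in\mathscr C}|\mu(C)-\mu_n(C)|\ge\varepsilon\Bigr\}\to0\quad(n\to\infty),$$ where $\mu_n(C)=\frac1n\#\{i:\sigma_i\in C\}$ is the empirical measure of the sample $\sigma$. 2. $\mathscr C$ is consistently PAC learnable under $P_{na}$, with the standard sample complexity. Namely, let $\mathcal L:\bigcup_{n\ge1}\Omega^n\times\{0,1\}^n\to\mathscr C$ be any learning rule, i.e. a map such that $\sigma\mapsto\mu(\mathcal L(\sigma,C\cap\sigma)\bigtriangleup C)$ is measurable on $\Omega^n$ for all $C\in\mathscr C$, $\mu\in P_{na}$, $n\ge1$ (where $C\cap\sigma\in\{0,1\}^n$ denotes the labelling of the points of $\sigma$ by membership in $C$), and let $\mathcal L$ be consistent, i.e. $\mathcal L(\sigma,C\cap\sigma)\cap\sigma=C\cap\sigma$ for all $C\in\mathscr C$ and all $\sigma$. Then for every $\varepsilon>0$ $$\sup_{\mu\in P_{na}}\ \sup_{C\in\mathscr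 C}\ \mu^{\otimes n}\bigl\{\sigma\in\Omega^n:\ \mu(\mathcal L(\sigma,C\cap\sigma)\bigtriangleup C)>\varepsilon\bigr\}\to0\quad(n\to\infty).$$ Moreover, for all $0<\varepsilon\le1$, $0<\delta\le1$, all $\mu\in P_{na}$, all $C\in\mathscr C$ and all integers $n\ge1$ with $$n\ \ge\ \frac{128}{\varepsilon^2}\left(d\log\Bigl(\frac{2e^2}{\varepsilon}\log\frac{2e}{\varepsilon}\Bigr)+\log\frac8\delta\right),$$ one has $\mu(\mathcal L(\sigma,C\cap\sigma)\bigtriangleup C)<\varepsilon$ with $\mu^{\otimes n}$-probability at least $1-\delta$. -/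

import Mathlib

open MeasureTheory Filter Topology
open scoped ENNReal symmDiff

noncomputable section

/-- `A 0, …, A (n-1)` is shattered by `𝒞`: for every set `J` of indices some member of `𝒞`
contains all `A i` with `i ∈ J` and is disjoint from all `A i` with `i ∉ J`. -/
def ShattersFamily {Ω : Type*} (𝒞 : Set (Set Ω)) {n : ℕ} (A : Fin n → Set Ω) : Prop :=
  ∀ J : Set (Fin n), ∃ C ∈ 𝒞, (∀ i ∈ J, A i ⊆ C) ∧ (∀ i ∉ J, Disjoint (A i) C)

/-- The VC dimension modulo countable sets: the supremum of the `n` such that some family of `n`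
uncountable subsets of `Ω` is shattered by `𝒞`. -/
def vcDimModCountable {Ω : Type*} (𝒞 : Set (Set Ω)) : ℕ∞ :=
  ⨆ n ∈ {n : ℕ | ∃ A : Fin n → Set Ω, (∀ i, ¬ (A i).Countable) ∧ ShattersFamily 𝒞 A}, (n : ℕ∞)

/-- `𝒞` contains a countable subfamily such that every member of `𝒞` is the pointwise limit of a
sequence from that subfamily. -/
def UniversallySeparable {Ω : Type*} (𝒞 : Set (Set Ω)) : Prop :=
  ∃ 𝒟 : Set (Set Ω), 𝒟 ⊆ 𝒞 ∧ 𝒟.Countable ∧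
    ∀ C ∈ 𝒞, ∃ D : ℕ → Set Ω, (∀ k, D k ∈ 𝒟) ∧
      ∀ x : Ω, ∃ N : ℕ, ∀ k ≥ N, (x ∈ D k ↔ x ∈ C)

/-- The family of all non-atomic probability measures on `Ω`: every set of positive measure
contains a subset of strictly smaller positive measure. -/
def nonatomicMeasures (Ω : Type*) [MeasurableSpace Ω] : Set (ProbabilityMeasure Ω) :=
  {μ | ∀ A : Set Ω, MeasurableSet A → 0 < (μ : Measure Ω) A →
    ∃ B ⊆ A, MeasurableSet B ∧ 0 < (μ : Measure Ω) B ∧ (μ : Measure Ω) B < (μ : Measure Ω) A}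

/-- The law `μ^{⊗ n}` of an i.i.d. sample of size `n`. On a set that is not measurable, its value
is the outer measure; on a set measurable for the completion, it is the completed measure. -/
def sampleLaw {Ω : Type*} [MeasurableSpace Ω] (μ : ProbabilityMeasure Ω) (n : ℕ) :
    Measure (Fin n → Ω) :=
  Measure.pi (fun _ : Fin n => (μ : Measure Ω))

open Classical in
/-- The empirical measure `μ_n(C)` of the set `C` for the sample `σ`. -/
def empiricalFreq {Ω : Type*} {n : ℕ} (σ : Fin n → Ω) (C : Set Ω) : ℝ :=
  ((Finset.univ.filter (fun i : Fin n => σ i ∈ C)).card : ℝ) / (n : ℝ)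

/-- The set of samples with `sup_{C ∈ 𝒞} |μ(C) - μ_n(C)| ≥ ε`. -/
def deviationEvent {Ω : Type*} [MeasurableSpace Ω] (𝒞 : Set (Set Ω)) (μ : ProbabilityMeasure Ω)
    (n : ℕ) (ε : ℝ) : Set (Fin n → Ω) :=
  {σ | ENNReal.ofReal ε ≤
    ⨆ C ∈ 𝒞, ENNReal.ofReal |(μ : Measure Ω).real C - empiricalFreq σ C|}

/-- `𝒞` is uniform Glivenko–Cantelli with regard to `P`: the deviation events are measurable (for
the completed product measures), and their probabilities tend to `0` uniformly over `P`. -/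
def UniformGlivenkoCantelli {Ω : Type*} [MeasurableSpace Ω] (𝒞 : Set (Set Ω))
    (P : Set (ProbabilityMeasure Ω)) : Prop :=
  ∀ ε : ℝ, 0 < ε →
    (∀ μ ∈ P, ∀ n : ℕ, NullMeasurableSet (deviationEvent 𝒞 μ n ε) (sampleLaw μ n)) ∧
    Tendsto (fun n : ℕ => ⨆ μ ∈ P, sampleLaw μ n (deviationEvent 𝒞 μ n ε)) atTop (𝓝 0)

open Classical in
/-- The labels `C ∩ σ` of the points of the sample `σ` given by the concept `C`. -/
def sampleLabels {Ω : Type*} {n : ℕ} (C : Set Ω) (σ : Fin n → Ω) : Fin n → Bool :=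
  fun i => decide (σ i ∈ C)

/-- A learning rule for `𝒞` under `P`: a map assigning a member of `𝒞` to each labelled sample of
size `n ≥ 1`, such that `σ ↦ μ(L(σ, C ∩ σ) ∆ C)` is measurable (for the completion of `μ^{⊗ n}`)
for all `C ∈ 𝒞` and `μ ∈ P`. The value of `hyp` at `n = 0` is irrelevant. -/
structure LearningRule {Ω : Type*} [MeasurableSpace Ω] (𝒞 : Set (Set Ω))
    (P : Set (ProbabilityMeasure Ω)) where
  hyp : (n : ℕ) → (Fin n → Ω) → (Fin n → Bool) → Set Ω
  hyp_mem : ∀ n : ℕ, 1 ≤ n → ∀ (σ : Fin n → Ω) (τ : Fin n → Bool), hyp n σ τ ∈ 𝒞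
  aemeasurable_error : ∀ C ∈ 𝒞, ∀ μ ∈ P, ∀ n : ℕ, 1 ≤ n →
    AEMeasurable (fun σ : Fin n → Ω => (μ : Measure Ω) (hyp n σ (sampleLabels C σ) ∆ C))
      (sampleLaw μ n)

namespace LearningRule

variable {Ω : Type*} [MeasurableSpace Ω] {𝒞 : Set (Set Ω)} {P : Set (ProbabilityMeasure Ω)}

/-- The error `μ(L(σ, C ∩ σ) ∆ C)`. -/
def error (L : LearningRule 𝒞 P) (μ : ProbabilityMeasure Ω) (C : Set Ω) {n : ℕ}
    (σ : Fin n → Ω) : ℝ≥0∞ :=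
  (μ : Measure Ω) (L.hyp n σ (sampleLabels C σ) ∆ C)

/-- `L(σ, C ∩ σ) ∩ σ = C ∩ σ` for all concepts `C` in `𝒞` and all samples `σ`. -/
def Consistent (L : LearningRule 𝒞 P) : Prop :=
  ∀ C ∈ 𝒞, ∀ n : ℕ, 1 ≤ n → ∀ σ : Fin n → Ω, ∀ i : Fin n,
    σ i ∈ L.hyp n σ (sampleLabels C σ) ↔ σ i ∈ C

/-- `L` is probably approximately correct under `P`. -/
def IsPAC (L : LearningRule 𝒞 P) : Prop :=
  ∀ ε : ℝ, 0 < ε →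
    Tendsto (fun n : ℕ => ⨆ μ ∈ P, ⨆ C ∈ 𝒞,
      sampleLaw μ n {σ | ENNReal.ofReal ε < L.error μ C σ}) atTop (𝓝 0)

/-- `L` learns with sample complexity `s`: for each concept in `𝒞` and each `μ ∈ P`, on an i.i.d.
sample of size at least `s ε δ` the error is less than `ε` with confidence at least `1 - δ`. -/
def HasSampleComplexity (L : LearningRule 𝒞 P) (s : ℝ → ℝ → ℝ) : Prop :=
  ∀ ε δ : ℝ, 0 < ε → ε ≤ 1 → 0 < δ → δ ≤ 1 → ∀ n : ℕ, 1 ≤ n → s ε δ ≤ (n : ℝ) →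
    ∀ μ ∈ P, ∀ C ∈ 𝒞,
      sampleLaw μ n {σ | ENNReal.ofReal ε ≤ L.error μ C σ} ≤ ENNReal.ofReal δ

end LearningRule

/-- Every learning rule consistent with `𝒞` is probably approximately correct under `P`. -/
def ConsistentlyLearnable {Ω : Type*} [MeasurableSpace Ω] (𝒞 : Set (Set Ω))
    (P : Set (ProbabilityMeasure Ω)) : Prop :=
  ∀ L : LearningRule 𝒞 P, L.Consistent → L.IsPAC

/-- The standard sample complexity bound
`(128 / ε²) (d log ((2 e² / ε) log (2 e / ε)) + log (8 / δ))`. -/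
def standardSampleComplexity (d : ℕ) (ε δ : ℝ) : ℝ :=
  128 / ε ^ 2 *
    ((d : ℝ) * Real.log (2 * Real.exp 1 ^ 2 / ε * Real.log (2 * Real.exp 1 / ε)) +
      Real.log (8 / δ))

end

/-! Let `𝒟` be the countable subclass given by universal separability. A shattered tuple comes with
a finite family of witnesses from `𝒟`, and there are only countably many such families. Each family
cuts `Ω` into cells, and uncountable cells would be shattered as sets. So deleting the countably
many countable cells leaves no shattered `(d + 1)`-tuple
(`exists_countable_forall_not_shattersTuple`). The deleted set `N` is countable, hence null for
every non-atomic measure, and does not depend on the measure.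

Off `N` the class `𝒟` has ordinary VC dimension at most `d`, and the classical argument applies with
constants depending only on `d`: symmetrization by a second sample, random swaps, Sauer–Shelah,
Hoeffding and a union bound (`measure_sampleDeviation_le`). Pointwise limits carry the bound from
`𝒟` to `𝒞`, since the measure of a set and its frequency in a fixed sample pass to the limit.

For learning, the bound is applied to the classes `{D ∆ C | D ∈ 𝒟}`, which have the same dimension
off the same `N`. A consistent hypothesis `H` has empirical error `0`, so its true error is exactly
the deviation of `H ∆ C`. -/

/-- `𝒞` cuts every subset out of the tuple `x`. -/
def ShattersTuple {Ω ι : Type*} (𝒞 : Set (Set Ω)) (x : ι → Ω) : Prop :=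
  ∀ J : Set ι, ∃ C ∈ 𝒞, ∀ i, x i ∈ C ↔ i ∈ J

/-- Taking the symmetric difference with a fixed set permutes the possible traces on `x`. Hence one
exceptional set serves all targets `C` at once. -/
lemma ShattersTuple.of_symmDiff {Ω ι : Type*} {𝒞 : Set (Set Ω)} {C : Set Ω} {x : ι → Ω}
    (h : ShattersTuple ((· ∆ C) '' 𝒞) x) : ShattersTuple 𝒞 x := by
  intro J
  obtain ⟨_, ⟨D, hD, rfl⟩, hx⟩ := h (J ∆ (x ⁻¹' C))
  refine ⟨D, hD, fun i => ?_⟩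
  have := hx i
  simp only [Set.mem_symmDiff, Set.mem_preimage] at this
  tauto

/-- A countable class that shatters no `m` uncountable sets shatters no `m`-tuple outside a suitable
countable set. -/
lemma exists_countable_forall_not_shattersTuple {Ω : Type*} {𝒟 : Set (Set Ω)} (h𝒟 : 𝒟.Countable)
    {m : ℕ} (hm : ∀ A : Fin m → Set Ω, (∀ i, ¬ (A i).Countable) → ¬ ShattersFamily 𝒟 A) :
    ∃ N : Set Ω, N.Countable ∧ ∀ x : Fin m → Ω, (∀ i, x i ∉ N) → ¬ ShattersTuple 𝒟 x := by
  classical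
  have : Countable 𝒟 := h𝒟.to_subtype
  -- The cell of `i` consists of all points that the witnesses `D J` cannot tell from the `i`-th
  -- member of a tuple shattered by them.
  let cell (D : Finset (Fin m) → 𝒟) (i : Fin m) : Set Ω :=
    {ω | ∀ J : Finset (Fin m), ω ∈ (D J : Set Ω) ↔ i ∈ J}
  refine ⟨⋃ (D : Finset (Fin m) → 𝒟) (i : Fin m) (_ : (cell D i).Countable), cell D i,
    Set.countable_iUnion fun D => Set.countable_iUnion fun i => Set.countable_iUnion id,
    fun x hx hsh => ?_⟩
  choose D hD hDx using fun J : Finset (Fin m) => hsh ↑J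
  let D' : Finset (Fin m) → 𝒟 := fun J => ⟨D J, hD J⟩
  have hcell (i : Fin m) : x i ∈ cell D' i := fun J => by simpa using hDx J i
  refine hm (cell D') (fun i hi => hx i ?_) fun J => ?_
  · simp only [Set.mem_iUnion]
    exact ⟨D', i, hi, hcell i⟩
  · refine ⟨D J.toFinset, hD _, fun i hi ω hω => (hω J.toFinset).2 (by simpa using hi),
      fun i hi => Set.disjoint_left.2 fun ω hω hωD => hi ?_⟩
    simpa using (hω J.toFinset).1 hωD

lemma exists_countable_forall_not_shattersTuple_of_vcDimModCountable {Ω : Type*}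
    {𝒞 𝒟 : Set (Set Ω)} (hsub : 𝒟 ⊆ 𝒞) (h𝒟 : 𝒟.Countable) {d : ℕ}
    (hd : vcDimModCountable 𝒞 ≤ d) :
    ∃ N : Set Ω, N.Countable ∧ ∀ x : Fin (d + 1) → Ω, (∀ i, x i ∉ N) → ¬ ShattersTuple 𝒟 x := by
  refine exists_countable_forall_not_shattersTuple h𝒟 fun A hA hsh => ?_
  have h : ((d + 1 : ℕ) : ℕ∞) ≤ vcDimModCountable 𝒞 :=
    le_iSup₂_of_le (d + 1)
      ⟨A, hA, fun J => (hsh J).imp fun C hC => ⟨hsub hC.1, hC.2⟩⟩ le_rfl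
  have := h.trans hd
  norm_cast at this
  omega

/-! ### Counting traces -/

open Classical in
/-- The traces of the members of `𝒞` on the tuple `x`. -/
noncomputable def traces {Ω ι : Type*} [Fintype ι] (𝒞 : Set (Set Ω)) (x : ι → Ω) :
    Finset (Finset ι) :=
  Finset.univ.filter fun T => ∃ C ∈ 𝒞, ∀ i, i ∈ T ↔ x i ∈ C

/-- Since `x ≤ 1`, weighting by `x ^ d` is dominated by weighting the `k`-th term by `x ^ k`, which
gives part of the binomial expansion of `(x + 1) ^ m`. Leaving `x` free allows a later choice and
needs no case `d ≤ m`. -/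
lemma sum_choose_le_inv_pow_mul_exp (m d : ℕ) {x : ℝ} (hx : 0 < x) (hx1 : x ≤ 1) :
    (∑ k ∈ Finset.Iic d, m.choose k : ℕ) ≤ x⁻¹ ^ d * Real.exp (m * x) := by
  have h1 : x ^ d * (∑ k ∈ Finset.Iic d, m.choose k : ℕ) ≤ (x + 1) ^ m := by
    rw [add_pow, Nat.cast_sum, Finset.mul_sum]
    calc ∑ k ∈ Finset.Iic d, x ^ d * (m.choose k : ℝ)
        ≤ ∑ k ∈ Finset.Iic d, x ^ k * (m.choose k : ℝ) := by
          refine Finset.sum_le_sum fun k hk => ?_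
          exact mul_le_mul_of_nonneg_right (pow_le_pow_of_le_one hx.le hx1 (Finset.mem_Iic.1 hk))
            (Nat.cast_nonneg _)
      _ ≤ ∑ k ∈ Finset.Iic (max d m), x ^ k * (m.choose k : ℝ) := by
          refine Finset.sum_le_sum_of_subset_of_nonneg
            (Finset.Iic_subset_Iic.2 (le_max_left _ _)) fun k _ _ => by positivity
      _ = ∑ k ∈ Finset.range (m + 1), x ^ k * (m.choose k : ℝ) := by
          symm
          refine Finset.sum_subset (fun k hk => ?_) fun k _ hk => ?_
          · simp at hk ⊢; omega
          · rw [Nat.choose_eq_zero_of_lt (by simpa using hk)]; simp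
      _ = _ := by simp
  have h2 : (x + 1) ^ m ≤ Real.exp (m * x) := by
    rw [Real.exp_nat_mul]
    gcongr
    exact Real.add_one_le_exp x
  rw [inv_pow, inv_mul_eq_div, le_div_iff₀ (by positivity), mul_comm]
  exact h1.trans h2

/-- The Sauer–Shelah bound for the number of traces. -/
lemma card_traces_le {Ω ι : Type*} [Fintype ι] {𝒞 : Set (Set Ω)} {N : Set Ω} {d : ℕ}
    (hN : ∀ x : Fin (d + 1) → Ω, (∀ i, x i ∉ N) → ¬ ShattersTuple 𝒞 x)
    {x : ι → Ω} (hx : ∀ i, x i ∉ N) {a : ℝ} (ha : 0 < a) (ha1 : a ≤ 1) :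
    ((traces 𝒞 x).card : ℝ) ≤ a⁻¹ ^ d * Real.exp (Fintype.card ι * a) := by
  classical
  have hdim : (traces 𝒞 x).vcDim ≤ d := by
    refine Finset.sup_le fun s hs => ?_
    by_contra! hcard
    obtain ⟨t, hts, ht⟩ := Finset.exists_subset_card_eq (Nat.succ_le_of_lt hcard)
    let e := t.equivFinOfCardEq ht
    -- A set of `d + 1` indices shattered by the traces would give a shattered tuple of points
    -- outside `N`.
    refine hN (fun i => x (e.symm i)) (fun i => hx _) fun J => ?_
    obtain ⟨u, hu, hsu⟩ := Finset.mem_shatterer.1 hs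
      (t := s.filter fun i => ∃ h : i ∈ t, e ⟨i, h⟩ ∈ J) (Finset.filter_subset _ _)
    obtain ⟨C, hC, huC⟩ := (Finset.mem_filter.1 hu).2
    refine ⟨C, hC, fun i => ?_⟩
    rw [← huC]
    have hi : (e.symm i : ι) ∈ s := hts (e.symm i).2
    have := congrArg ((e.symm i : ι) ∈ ·) hsu
    simpa [hi] using this
  have h1 : (traces 𝒞 x).card ≤ ∑ k ∈ Finset.Iic d, (Fintype.card ι).choose k :=
    ((traces 𝒞 x).card_le_card_shatterer.trans Finset.card_shatterer_le_sum_vcDim).trans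
      (Finset.sum_le_sum_of_subset (Finset.Iic_subset_Iic.2 hdim))
  exact (Nat.cast_le.2 h1).trans (sum_choose_le_inv_pow_mul_exp _ _ ha ha1)

/-! ### Random signs -/

/-- The sign `±1` encoded by a Boolean. -/
def boolSign (b : Bool) : ℝ := if b then -1 else 1

/-- The sum over sign vectors factors over the coordinates into terms `2 cosh (r a i) ≤ 2 exp (r² /
2)`. -/
lemma sum_exp_signed_sum_le {ι : Type*} [Fintype ι] [DecidableEq ι] {a : ι → ℝ}
    (ha : ∀ i, |a i| ≤ 1) (r : ℝ) :
    ∑ s : ι → Bool, Real.exp (r * ∑ i, boolSign (s i) * a i) ≤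
      2 ^ Fintype.card ι * Real.exp (Fintype.card ι * (r ^ 2 / 2)) := by
  have h1 : ∑ s : ι → Bool, Real.exp (r * ∑ i, boolSign (s i) * a i) =
      ∏ i, ∑ b : Bool, Real.exp (r * (boolSign b * a i)) := by
    rw [Finset.prod_univ_sum, Fintype.piFinset_univ]
    exact Finset.sum_congr rfl fun s _ => by rw [Finset.mul_sum, Real.exp_sum]
  rw [h1, Real.exp_nat_mul, ← mul_pow]
  refine (Finset.prod_le_prod (fun i _ => by positivity) (g := fun _ => 2 * Real.exp (r ^ 2 / 2))
    fun i _ => ?_).trans_eq (by simp)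
  have h2 : ∑ b : Bool, Real.exp (r * (boolSign b * a i)) = 2 * Real.cosh (r * a i) := by
    rw [Real.cosh_eq]; simp [boolSign]; ring
  rw [h2]
  have h3 : (r * a i) ^ 2 ≤ r ^ 2 := by
    rw [mul_pow]
    exact mul_le_of_le_one_right (sq_nonneg r) ((sq_le_one_iff_abs_le_one _).2 (ha i))
  gcongr
  exact (Real.cosh_le_exp_half_sq _).trans (by gcongr)

/-- Hoeffding's inequality for random signs, one-sided, in counting form. -/
lemma card_lt_signed_sum_le {ι : Type*} [Fintype ι] [DecidableEq ι] [Nonempty ι] {a : ι → ℝ}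
    (ha : ∀ i, |a i| ≤ 1) {r : ℝ} (hr : 0 ≤ r) :
    ((Finset.univ.filter fun s : ι → Bool =>
      Fintype.card ι * r < ∑ i, boolSign (s i) * a i).card : ℝ) ≤
      2 ^ Fintype.card ι * Real.exp (-(Fintype.card ι * r ^ 2 / 2)) := by
  set n : ℝ := ((Fintype.card ι : ℕ) : ℝ)
  set F := Finset.univ.filter fun s : ι → Bool => n * r < ∑ i, boolSign (s i) * a i
  -- Chernoff's method; the exponential parameter `r` minimizes `n λ² / 2 - λ n r` over `λ`.
  have h1 : (F.card : ℝ) * Real.exp (r * (n * r)) ≤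
      2 ^ Fintype.card ι * Real.exp (n * (r ^ 2 / 2)) := by
    refine le_trans ?_ (sum_exp_signed_sum_le ha r)
    rw [← nsmul_eq_mul]
    refine (Finset.card_nsmul_le_sum F (fun s => Real.exp (r * ∑ i, boolSign (s i) * a i)) _
      fun s hs => ?_).trans (Finset.sum_le_univ_sum_of_nonneg fun s => by positivity)
    have := (Finset.mem_filter.1 hs).2
    gcongr
  rw [← le_div_iff₀ (by positivity), mul_div_assoc, ← Real.exp_sub] at h1
  refine h1.trans_eq ?_
  congr 2
  ring

/-- Hoeffding's inequality for random signs, in counting form. -/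
lemma card_lt_abs_signed_sum_le {ι : Type*} [Fintype ι] [DecidableEq ι] [Nonempty ι] {a : ι → ℝ}
    (ha : ∀ i, |a i| ≤ 1) {r : ℝ} (hr : 0 ≤ r) :
    ((Finset.univ.filter fun s : ι → Bool =>
      Fintype.card ι * r < |∑ i, boolSign (s i) * a i|).card : ℝ) ≤
      2 * (2 ^ Fintype.card ι * Real.exp (-(Fintype.card ι * r ^ 2 / 2))) := by
  have h1 := card_lt_signed_sum_le ha hr
  have h2 := card_lt_signed_sum_le (a := fun i => -a i) (by simpa using ha) hr
  rw [two_mul]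
  refine le_trans ?_ (add_le_add h1 h2)
  norm_cast
  refine le_trans (Finset.card_le_card fun s hs => ?_) (Finset.card_union_le _ _)
  simpa [lt_abs] using hs

/-! ### Random swaps of a double sample -/

/-- Averaging over `s` and exchanging sum and integral reduces a bound on `ν B` to counting, for
almost every fixed `z`, the `s` that move `z` into `B`. -/
lemma card_mul_measure_le_of_measurePreserving {X S : Type*} [MeasurableSpace X] [Fintype S]
    {ν : Measure X} [IsProbabilityMeasure ν] {g : S → X → X}
    (hg : ∀ s, MeasurePreserving (g s) ν ν) {B : Set X} (hB : MeasurableSet B) [DecidablePred (· ∈ B)]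
    {K : ℝ} (hK : ∀ᵐ z ∂ν, ((Finset.univ.filter fun s => g s z ∈ B).card : ℝ) ≤ K) :
    (Fintype.card S : ℝ≥0∞) * ν B ≤ ENNReal.ofReal K := by
  have h1 (s : S) : ν B = ∫⁻ z, (B.indicator 1 (g s z) : ℝ≥0∞) ∂ν := by
    rw [(hg s).lintegral_comp (f := B.indicator 1) (measurable_one.indicator hB),
      lintegral_indicator_one hB]
  calc (Fintype.card S : ℝ≥0∞) * ν B = ∑ s : S, ∫⁻ z, (B.indicator 1 (g s z) : ℝ≥0∞) ∂ν := by
        simp [← h1]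
    _ = ∫⁻ z, ∑ s : S, (B.indicator 1 (g s z) : ℝ≥0∞) ∂ν := by
        rw [lintegral_finsetSum]
        exact fun s _ => (measurable_one.indicator hB).comp (hg s).measurable
    _ ≤ ∫⁻ _, ENNReal.ofReal K ∂ν := by
        refine lintegral_mono_ae (hK.mono fun z hz => ?_)
        have h2 : ∑ s : S, (B.indicator 1 (g s z) : ℝ≥0∞) =
            ENNReal.ofReal ((Finset.univ.filter fun s => g s z ∈ B).card : ℝ) := by
          simp [Set.indicator_apply, Finset.sum_boole]
        exact h2.trans_le (ENNReal.ofReal_le_ofReal hz)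
    _ = _ := by simp

/-- Exchange the two members of each pair whose sign is `true`. -/
def swapPairs {Ω ι : Type*} (s : ι → Bool) (z : ι → Ω × Ω) : ι → Ω × Ω :=
  fun i => if s i then (z i).swap else z i

/-- The excess of the first over the second sample in `D`, for the `i`-th pair. -/
noncomputable def pairExcess {Ω : Type*} (D : Set Ω) (p : Ω × Ω) : ℝ :=
  D.indicator 1 p.1 - D.indicator 1 p.2

lemma pairExcess_swapPairs {Ω ι : Type*} (D : Set Ω) (s : ι → Bool) (z : ι → Ω × Ω) (i : ι) :
    pairExcess D (swapPairs s z i) = boolSign (s i) * pairExcess D (z i) := by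
  unfold pairExcess swapPairs boolSign
  split_ifs <;> simp

lemma abs_pairExcess_le_one {Ω : Type*} (D : Set Ω) (p : Ω × Ω) : |pairExcess D p| ≤ 1 := by
  classical
  simp only [pairExcess, Set.indicator_apply, Pi.one_apply]
  split_ifs <;> simp

lemma measurable_pairExcess {Ω : Type*} [MeasurableSpace Ω] {D : Set Ω} (hD : MeasurableSet D) :
    Measurable (pairExcess D) :=
  ((measurable_one.indicator hD).comp measurable_fst).sub
    ((measurable_one.indicator hD).comp measurable_snd)

lemma measurePreserving_swapPairs {Ω ι : Type*} [MeasurableSpace Ω] [Fintype ι] (μ : Measure Ω)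
    [IsProbabilityMeasure μ] (s : ι → Bool) :
    MeasurePreserving (swapPairs s) (Measure.pi fun _ : ι => μ.prod μ)
      (Measure.pi fun _ : ι => μ.prod μ) := by
  refine measurePreserving_pi (f := fun i (p : Ω × Ω) => if s i then p.swap else p)
    (fun _ => μ.prod μ) (fun _ => μ.prod μ) fun i => ?_
  by_cases h : s i
  · simpa [h] using! Measure.measurePreserving_swap (μ := μ) (ν := μ)
  · simpa [h] using! MeasurePreserving.id (μ.prod μ)

/-- The pairs of samples on which the frequencies of some member of `𝒟` differ by more than `r`. -/
def pairDeviation {Ω : Type*} (ι : Type*) [Fintype ι] (𝒟 : Set (Set Ω)) (r : ℝ) :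
    Set (ι → Ω × Ω) :=
  {z | ∃ D ∈ 𝒟, Fintype.card ι * r < |∑ i, pairExcess D (z i)|}

lemma measurableSet_pairDeviation {Ω ι : Type*} [MeasurableSpace Ω] [Fintype ι] {𝒟 : Set (Set Ω)}
    (h𝒟 : 𝒟.Countable) (hmeas : ∀ D ∈ 𝒟, MeasurableSet D) (r : ℝ) :
    MeasurableSet (pairDeviation ι 𝒟 r) := by
  have : pairDeviation ι 𝒟 r =
      ⋃ D ∈ 𝒟, {z | Fintype.card ι * r < |∑ i, pairExcess D (z i)|} := by
    ext; simp [pairDeviation]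
  rw [this]
  refine MeasurableSet.biUnion h𝒟 fun D hD => measurableSet_lt measurable_const ?_
  exact (Finset.measurable_fun_sum _ fun i _ =>
    (measurable_pairExcess (hmeas D hD)).comp (measurable_pi_apply i)).abs

open Classical in
lemma card_swapPairs_mem_pairDeviation_le {Ω ι : Type*} [Fintype ι] [Nonempty ι]
    {𝒟 : Set (Set Ω)} {N : Set Ω} {d : ℕ}
    (hN : ∀ x : Fin (d + 1) → Ω, (∀ i, x i ∉ N) → ¬ ShattersTuple 𝒟 x)
    {z : ι → Ω × Ω} (hz : ∀ i, (z i).1 ∉ N ∧ (z i).2 ∉ N) {a r : ℝ} (ha : 0 < a) (ha1 : a ≤ 1)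
    (hr : 0 ≤ r) :
    ((Finset.univ.filter fun s : ι → Bool => swapPairs s z ∈ pairDeviation ι 𝒟 r).card : ℝ) ≤
      a⁻¹ ^ d * Real.exp (2 * Fintype.card ι * a) *
        (2 * (2 ^ Fintype.card ι * Real.exp (-(Fintype.card ι * r ^ 2 / 2)))) := by
  set x : ι × Bool → Ω := fun p => if p.2 then (z p.1).2 else (z p.1).1 with hxdef
  have hx (p : ι × Bool) : x p ∉ N := by
    rw [hxdef]; dsimp only; split_ifs
    exacts [(hz _).2, (hz _).1]
  -- The excess depends on `D` only through its trace `T` on the doubled sample, so the union bound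
  -- runs over finitely many traces.
  set b : Finset (ι × Bool) → ι → ℝ := fun T i =>
    (if (i, false) ∈ T then 1 else 0) - (if (i, true) ∈ T then 1 else 0) with hb
  have hb1 (T) (i) : |b T i| ≤ 1 := by rw [hb]; dsimp only; split_ifs <;> simp
  set M : ℝ := 2 * (2 ^ Fintype.card ι * Real.exp (-(Fintype.card ι * r ^ 2 / 2)))
  have hsub : (Finset.univ.filter fun s : ι → Bool => swapPairs s z ∈ pairDeviation ι 𝒟 r) ⊆
      (traces 𝒟 x).biUnion fun T => Finset.univ.filter fun s : ι → Bool =>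
        Fintype.card ι * r < |∑ i, boolSign (s i) * b T i| := by
    intro s hs
    obtain ⟨D, hD, hlt⟩ := (Finset.mem_filter.1 hs).2
    simp only [Finset.mem_biUnion, Finset.mem_filter, Finset.mem_univ, true_and]
    refine ⟨Finset.univ.filter fun p => x p ∈ D,
      Finset.mem_filter.2 ⟨Finset.mem_univ _, D, hD, by simp⟩, ?_⟩
    convert hlt using 4 with i
    rw [pairExcess_swapPairs]
    simp [hb, hxdef, pairExcess, Set.indicator_apply]
  have hcard := (Finset.card_le_card hsub).trans Finset.card_biUnion_le
  calc _ ≤ ((∑ T ∈ traces 𝒟 x, (Finset.univ.filter fun s : ι → Bool =>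
        Fintype.card ι * r < |∑ i, boolSign (s i) * b T i|).card : ℕ) : ℝ) := Nat.cast_le.2 hcard
    _ ≤ (traces 𝒟 x).card * M := by
        rw [Nat.cast_sum]
        exact (Finset.sum_le_card_nsmul _ _ _ fun T _ =>
          card_lt_abs_signed_sum_le (hb1 T) hr).trans_eq (nsmul_eq_mul _ _)
    _ ≤ _ := by
        have h := card_traces_le hN hx ha ha1
        have h2 : (Fintype.card (ι × Bool) : ℝ) = 2 * Fintype.card ι := by
          simp [mul_comm]
        rw [h2] at h
        gcongr

lemma measure_pairDeviation_le {Ω ι : Type*} [MeasurableSpace Ω] [Fintype ι] [Nonempty ι]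
    {𝒟 : Set (Set Ω)} (h𝒟 : 𝒟.Countable) (hmeas : ∀ D ∈ 𝒟, MeasurableSet D)
    (μ : Measure Ω) [IsProbabilityMeasure μ] {N : Set Ω} (hN0 : μ N = 0) {d : ℕ}
    (hN : ∀ x : Fin (d + 1) → Ω, (∀ i, x i ∉ N) → ¬ ShattersTuple 𝒟 x)
    {a r : ℝ} (ha : 0 < a) (ha1 : a ≤ 1) (hr : 0 ≤ r) :
    Measure.pi (fun _ : ι => μ.prod μ) (pairDeviation ι 𝒟 r) ≤
      ENNReal.ofReal (2 * a⁻¹ ^ d * Real.exp (2 * Fintype.card ι * a) *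
        Real.exp (-(Fintype.card ι * r ^ 2 / 2))) := by
  classical
  have hae : ∀ᵐ z ∂(Measure.pi fun _ : ι => μ.prod μ), ∀ i, (z i).1 ∉ N ∧ (z i).2 ∉ N := by
    have h0 : ∀ᵐ ω ∂μ, ω ∉ N := measure_eq_zero_iff_ae_notMem.1 hN0
    have h1 : ∀ᵐ p ∂(μ.prod μ), p.1 ∉ N ∧ p.2 ∉ N :=
      (Measure.quasiMeasurePreserving_fst.ae h0).and (Measure.quasiMeasurePreserving_snd.ae h0)
    rw [ae_all_iff]
    exact fun i => (measurePreserving_eval (fun _ : ι => μ.prod μ) i).quasiMeasurePreserving.ae h1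
  have h := card_mul_measure_le_of_measurePreserving (measurePreserving_swapPairs (ι := ι) μ)
    (measurableSet_pairDeviation h𝒟 hmeas r)
    (hae.mono fun z hz => card_swapPairs_mem_pairDeviation_le hN hz ha ha1 hr)
  have h2 : (Fintype.card (ι → Bool) : ℝ≥0∞) = ENNReal.ofReal (2 ^ Fintype.card ι) := by
    rw [ENNReal.ofReal_pow (by norm_num)]; simp
  rw [h2, mul_comm, ← ENNReal.le_div_iff_mul_le (by simp) (by simp),
    ← ENNReal.ofReal_div_of_pos (by positivity)] at h
  refine h.trans_eq (congrArg _ ?_)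
  field_simp

/-! ### Symmetrization -/

/-- The samples on which the frequency of some member of `𝒟` deviates by more than `t` from its
measure. -/
def sampleDeviation {Ω : Type*} [MeasurableSpace Ω] (𝒟 : Set (Set Ω)) (μ : Measure Ω) (n : ℕ)
    (t : ℝ) : Set (Fin n → Ω) :=
  {σ | ∃ D ∈ 𝒟, t < |μ.real D - empiricalFreq σ D|}

lemma empiricalFreq_eq_sum {Ω : Type*} {n : ℕ} (σ : Fin n → Ω) (D : Set Ω) :
    empiricalFreq σ D = (∑ i, D.indicator 1 (σ i)) / n := by
  classical
  simp [empiricalFreq, Set.indicator_apply, Finset.sum_boole]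

lemma measurable_empiricalFreq {Ω : Type*} [MeasurableSpace Ω] {n : ℕ} {D : Set Ω}
    (hD : MeasurableSet D) : Measurable fun σ : Fin n → Ω => empiricalFreq σ D := by
  simp only [empiricalFreq_eq_sum]
  exact (Finset.measurable_fun_sum _ fun i _ =>
    (measurable_one.indicator hD).comp (measurable_pi_apply i)).div_const _

lemma measurableSet_sampleDeviation {Ω : Type*} [MeasurableSpace Ω] {𝒟 : Set (Set Ω)}
    (h𝒟 : 𝒟.Countable) (hmeas : ∀ D ∈ 𝒟, MeasurableSet D) (μ : Measure Ω) (n : ℕ) (t : ℝ) :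
    MeasurableSet (sampleDeviation 𝒟 μ n t) := by
  have : sampleDeviation 𝒟 μ n t = ⋃ D ∈ 𝒟, {σ | t < |μ.real D - empiricalFreq σ D|} := by
    ext; simp [sampleDeviation]
  rw [this]
  exact MeasurableSet.biUnion h𝒟 fun D hD => measurableSet_lt measurable_const
    ((measurable_empiricalFreq (hmeas D hD)).const_sub _).abs

/-- Chebyshev's inequality for the empirical frequency of one set. -/
lemma measure_empiricalFreq_deviation_le_half {Ω : Type*} [MeasurableSpace Ω] (μ : Measure Ω)
    [IsProbabilityMeasure μ] {n : ℕ} (hn : 0 < n) {D : Set Ω} (hD : MeasurableSet D) {c : ℝ}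
    (hc : 0 < c) (hnc : 1 ≤ 2 * n * c ^ 2) :
    Measure.pi (fun _ : Fin n => μ) {σ | c ≤ |μ.real D - empiricalFreq σ D|} ≤ 1 / 2 := by
  set P := Measure.pi (fun _ : Fin n => μ)
  set X : Ω → ℝ := fun ω => D.indicator 1 ω / n
  have hXm : Measurable X := (measurable_one.indicator hD).div_const _
  have hX01 (ω) : X ω ∈ Set.Icc (0 : ℝ) (1 / n) := by
    classical
    simp only [X, Set.indicator_apply, Pi.one_apply]
    split_ifs <;> simp
  have hX2 : MemLp X 2 μ := MemLp.of_bound hXm.aestronglyMeasurable (1 / n)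
    (ae_of_all _ fun ω => by rw [Real.norm_of_nonneg (hX01 ω).1]; exact (hX01 ω).2)
  have hF : (fun σ : Fin n → Ω => empiricalFreq σ D) = ∑ i, fun σ => X (σ i) := by
    ext σ; simp [empiricalFreq_eq_sum, X, Finset.sum_div]
  have hXi (i : Fin n) : MemLp (fun σ : Fin n → Ω => X (σ i)) 2 P :=
    hX2.comp_measurePreserving (measurePreserving_eval (fun _ : Fin n => μ) i)
  have hFmem : MemLp (fun σ : Fin n → Ω => empiricalFreq σ D) 2 P := by
    rw [hF]; exact memLp_finsetSum' _ fun i _ => hXi i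
  have hmean : ∫ σ, empiricalFreq σ D ∂P = μ.real D := by
    have h1 : ∀ i : Fin n, ∫ σ : Fin n → Ω, X (σ i) ∂P = μ.real D / n := fun i => by
      rw [integral_comp_eval (μ := fun _ : Fin n => μ) hXm.aestronglyMeasurable]
      simp [X, integral_div, integral_indicator_one hD]
    have h2 : ∫ σ, empiricalFreq σ D ∂P = ∑ i : Fin n, ∫ σ, X (σ i) ∂P := by
      rw [← integral_finsetSum _ fun i _ => (hXi i).integrable (by norm_num)]
      refine integral_congr_ae (ae_of_all _ fun σ => ?_)
      simpa using congrFun hF σ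
    rw [h2, Finset.sum_congr rfl fun i _ => h1 i]
    simp; field_simp
  -- A variable with values in an interval of length `1 / n` has variance at most `(1 / (2n))²`; the
  -- sum over `n` coordinates gives `1 / (4n) ≤ c² / 2`.
  have hvar : ProbabilityTheory.variance (fun σ : Fin n → Ω => empiricalFreq σ D) P ≤
      n * ((1 / n - 0) / 2) ^ 2 := by
    rw [hF, ProbabilityTheory.variance_sum_pi fun _ => hX2]
    refine (Finset.sum_le_card_nsmul _ _ _ fun i _ =>
      ProbabilityTheory.variance_le_sq_of_bounded (ae_of_all _ hX01) hXm.aemeasurable).trans_eq ?_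
    simp
  have hcheb := ProbabilityTheory.meas_ge_le_variance_div_sq hFmem hc
  rw [hmean] at hcheb
  simp_rw [abs_sub_comm (μ.real D)]
  refine hcheb.trans ?_
  have h4 : (1 / 2 : ℝ≥0∞) = ENNReal.ofReal (1 / 2) := by
    rw [ENNReal.ofReal_div_of_pos (by norm_num)]; simp
  rw [h4]
  refine ENNReal.ofReal_le_ofReal ?_
  rw [div_le_iff₀ (by positivity)]
  refine hvar.trans ?_
  have hn' : (0 : ℝ) < n := by exact_mod_cast hn
  have h5 : (n : ℝ) * ((1 / n - 0) / 2) ^ 2 = 1 / (4 * n) := by field_simp; ring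
  rw [h5, div_le_iff₀ (by positivity)]
  nlinarith

/-- Symmetrization by a second sample. -/
lemma measure_sampleDeviation_le_two_mul {Ω : Type*} [MeasurableSpace Ω] {𝒟 : Set (Set Ω)}
    (h𝒟 : 𝒟.Countable) (hmeas : ∀ D ∈ 𝒟, MeasurableSet D) (μ : Measure Ω) [IsProbabilityMeasure μ]
    {n : ℕ} (hn : 0 < n) {t : ℝ} (ht : 0 < t) (hnt : 2 ≤ n * t ^ 2) :
    Measure.pi (fun _ : Fin n => μ) (sampleDeviation 𝒟 μ n t) ≤
      2 * Measure.pi (fun _ : Fin n => μ.prod μ) (pairDeviation (Fin n) 𝒟 (t / 2)) := by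
  set P := Measure.pi (fun _ : Fin n => μ)
  set e := MeasurableEquiv.arrowProdEquivProdArrow Ω Ω (Fin n)
  have he : MeasurePreserving e (Measure.pi fun _ : Fin n => μ.prod μ) (P.prod P) :=
    measurePreserving_arrowProdEquivProdArrow Ω Ω (Fin n) (fun _ => μ) fun _ => μ
  set B := e.symm ⁻¹' pairDeviation (Fin n) 𝒟 (t / 2)
  have hBm : MeasurableSet B := e.symm.measurable (measurableSet_pairDeviation h𝒟 hmeas _)
  have hPB : Measure.pi (fun _ : Fin n => μ.prod μ) (pairDeviation (Fin n) 𝒟 (t / 2)) =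
      (P.prod P) B := by
    rw [← he.measure_preimage hBm.nullMeasurableSet]
    congr 1
  have hAm := measurableSet_sampleDeviation h𝒟 hmeas μ n t
  have hn' : (0 : ℝ) < n := by exact_mod_cast hn
  -- The set `D` may depend on `σ`, but it stays fixed while the second sample varies, so Chebyshev
  -- for a single set suffices.
  have hfiber : ∀ σ ∈ sampleDeviation 𝒟 μ n t, 1 / 2 ≤ P (Prod.mk σ ⁻¹' B) := by
    rintro σ ⟨D, hD, hlt⟩
    have hcheb := measure_empiricalFreq_deviation_le_half μ hn (hmeas D hD) (half_pos ht)
      (by nlinarith)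
    set E : Set (Fin n → Ω) := {σ | t / 2 ≤ |μ.real D - empiricalFreq σ D|}
    have hEm : MeasurableSet E :=
      measurableSet_le measurable_const ((measurable_empiricalFreq (hmeas D hD)).const_sub _).abs
    have h1 : (1 / 2 : ℝ≥0∞) ≤ P Eᶜ := by
      rw [prob_compl_eq_one_sub hEm]
      calc (1 / 2 : ℝ≥0∞) = 1 - 1 / 2 := by simp
        _ ≤ 1 - P E := tsub_le_tsub_left hcheb _
    refine h1.trans (measure_mono fun σ' hσ' => ?_)
    have h2 : |μ.real D - empiricalFreq σ' D| < t / 2 := not_le.1 hσ'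
    refine ⟨D, hD, ?_⟩
    have h3 : ∑ i, pairExcess D (e.symm (σ, σ') i) =
        n * (empiricalFreq σ D - empiricalFreq σ' D) := by
      rw [empiricalFreq_eq_sum, empiricalFreq_eq_sum, ← sub_div, mul_div_cancel₀ _ hn'.ne',
        ← Finset.sum_sub_distrib]
      rfl
    rw [h3, abs_mul, abs_of_pos hn', Fintype.card_fin]
    refine mul_lt_mul_of_pos_left ?_ hn'
    have h4 := abs_sub_le (μ.real D) (empiricalFreq σ' D) (empiricalFreq σ D)
    rw [abs_sub_comm (empiricalFreq σ' D)] at h4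
    linarith
  have h5 : 1 / 2 * P (sampleDeviation 𝒟 μ n t) ≤ (P.prod P) B := by
    rw [Measure.prod_apply hBm, ← lintegral_indicator_const hAm]
    refine lintegral_mono fun σ => ?_
    by_cases hσ : σ ∈ sampleDeviation 𝒟 μ n t
    · simpa [hσ] using hfiber σ hσ
    · simp [hσ]
  rw [hPB]
  calc P (sampleDeviation 𝒟 μ n t) = 2 * (1 / 2 * P (sampleDeviation 𝒟 μ n t)) := by
        rw [← mul_assoc, one_div, ENNReal.mul_inv_cancel (by simp) (by simp), one_mul]
    _ ≤ _ := by gcongr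

/-- The Vapnik–Chervonenkis inequality for a countable class without shattered `(d + 1)`-tuples
outside a null set. -/
lemma measure_sampleDeviation_le {Ω : Type*} [MeasurableSpace Ω] {𝒟 : Set (Set Ω)}
    (h𝒟 : 𝒟.Countable) (hmeas : ∀ D ∈ 𝒟, MeasurableSet D) (μ : Measure Ω) [IsProbabilityMeasure μ]
    {N : Set Ω} (hN0 : μ N = 0) {d : ℕ}
    (hN : ∀ x : Fin (d + 1) → Ω, (∀ i, x i ∉ N) → ¬ ShattersTuple 𝒟 x)
    {n : ℕ} {t a : ℝ} (ht : 0 < t) (hnt : 2 ≤ n * t ^ 2) (ha : 0 < a) (ha1 : a ≤ 1) :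
    Measure.pi (fun _ : Fin n => μ) (sampleDeviation 𝒟 μ n t) ≤
      ENNReal.ofReal (4 * a⁻¹ ^ d * Real.exp (2 * n * a - n * t ^ 2 / 8)) := by
  have hn : 0 < n := by
    rcases Nat.eq_zero_or_pos n with rfl | h
    · norm_num at hnt
    · exact h
  have : Nonempty (Fin n) := ⟨⟨0, hn⟩⟩
  have h := measure_pairDeviation_le (ι := Fin n) h𝒟 hmeas μ hN0 hN ha ha1 (half_pos ht).le
  refine (measure_sampleDeviation_le_two_mul h𝒟 hmeas μ hn ht hnt).trans
    ((mul_le_mul_right h 2).trans_eq ?_)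
  rw [← ENNReal.ofReal_ofNat 2, ← ENNReal.ofReal_mul (by norm_num), Fintype.card_fin, sub_eq_add_neg,
    Real.exp_add]
  congr 1
  ring_nf

/-! ### Null sets and pointwise limits -/

lemma measure_eq_zero_of_countable_of_mem_nonatomicMeasures {Ω : Type*} [MeasurableSpace Ω]
    [MeasurableSingletonClass Ω] {μ : ProbabilityMeasure Ω} (hμ : μ ∈ nonatomicMeasures Ω)
    {N : Set Ω} (hN : N.Countable) : (μ : Measure Ω) N = 0 := by
  rw [← Set.biUnion_of_singleton N, measure_biUnion_null_iff hN]
  intro x _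
  by_contra hx
  obtain ⟨B, hB, -, hpos, hlt⟩ := hμ {x} (measurableSet_singleton x) (pos_iff_ne_zero.2 hx)
  rcases Set.subset_singleton_iff_eq.1 hB with rfl | rfl
  · simp at hpos
  · exact hlt.false

/-- Deviations pass to pointwise limits of sets. -/
lemma tendsto_abs_measureReal_sub_empiricalFreq {Ω : Type*} [MeasurableSpace Ω] (μ : Measure Ω)
    [IsProbabilityMeasure μ] {n : ℕ} (σ : Fin n → Ω) {D : ℕ → Set Ω} {C : Set Ω}
    (hD : ∀ k, MeasurableSet (D k)) (h : ∀ x, ∃ N, ∀ k ≥ N, (x ∈ D k ↔ x ∈ C)) :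
    Tendsto (fun k => |μ.real (D k) - empiricalFreq σ (D k)|) atTop
      (𝓝 |μ.real C - empiricalFreq σ C|) := by
  have h1 : Tendsto (fun k => μ.real (D k)) atTop (𝓝 (μ.real C)) :=
    (ENNReal.tendsto_toReal (measure_ne_top μ C)).comp
      (tendsto_measure_of_tendsto_indicator_of_isFiniteMeasure atTop μ hD
        fun x => eventually_atTop.2 (h x))
  have h2 : ∀ᶠ k in atTop, empiricalFreq σ (D k) = empiricalFreq σ C := by
    have h3 : ∀ᶠ k in atTop, ∀ i, (σ i ∈ D k ↔ σ i ∈ C) :=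
      eventually_all.2 fun i => eventually_atTop.2 (h (σ i))
    refine h3.mono fun k hk => ?_
    classical
    simp only [empiricalFreq_eq_sum, Set.indicator_apply, hk]
  exact (h1.sub (tendsto_const_nhds.congr' (h2.mono fun _ hk => hk.symm))).abs

lemma exists_deviation_lt_of_pointwise_limit {Ω : Type*} [MeasurableSpace Ω] {𝒟 : Set (Set Ω)}
    (hmeas : ∀ D ∈ 𝒟, MeasurableSet D) (μ : Measure Ω) [IsProbabilityMeasure μ] {n : ℕ}
    {σ : Fin n → Ω} {C : Set Ω}
    (h : ∃ D : ℕ → Set Ω, (∀ k, D k ∈ 𝒟) ∧ ∀ x, ∃ N, ∀ k ≥ N, (x ∈ D k ↔ x ∈ C)) {t : ℝ}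
    (ht : t < |μ.real C - empiricalFreq σ C|) : σ ∈ sampleDeviation 𝒟 μ n t := by
  obtain ⟨D, hD, hDC⟩ := h
  obtain ⟨k, hk⟩ := ((tendsto_abs_measureReal_sub_empiricalFreq μ σ
    (fun k => hmeas _ (hD k)) hDC).eventually_const_lt ht).exists
  exact ⟨D k, hD k, hk⟩

/-! ### Explicit constants -/

/-- The Vapnik–Chervonenkis confidence bound in terms of `d`, `ε` and the sample size. -/
noncomputable def confidenceBound (d : ℕ) (ε : ℝ) (n : ℕ) : ℝ :=
  4 * (128 / ε ^ 2) ^ d * Real.exp (-(n * (ε ^ 2 / 64)))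

lemma tendsto_confidenceBound (d : ℕ) {ε : ℝ} (hε : 0 < ε) :
    Tendsto (confidenceBound d ε) atTop (𝓝 0) := by
  have h : Tendsto (fun n : ℕ => (n : ℝ) * (ε ^ 2 / 64)) atTop atTop :=
    tendsto_natCast_atTop_atTop.atTop_mul_const (by positivity)
  simpa [confidenceBound, Function.comp_def] using!
    (Real.tendsto_exp_neg_atTop_nhds_zero.comp h).const_mul (4 * (128 / ε ^ 2) ^ d)

lemma eight_le_and_confidenceBound_le {d n : ℕ} {ε δ : ℝ} (hε : 0 < ε) (hε1 : ε ≤ 1) (hδ : 0 < δ)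
    (hδ1 : δ ≤ 1) (h : standardSampleComplexity d ε δ ≤ n) :
    8 ≤ n * ε ^ 2 ∧ confidenceBound d ε n ≤ δ := by
  set l := Real.log (2 * Real.exp 1 / ε) with hl
  set q := 2 * Real.exp 1 ^ 2 / ε * l
  have he : 2 ≤ Real.exp 1 := by linarith [Real.add_one_le_exp (1 : ℝ)]
  have hl1 : 1 ≤ l := by
    rw [hl, Real.le_log_iff_exp_le (by positivity), le_div_iff₀ hε]
    nlinarith
  have he27 : 27 / 10 ≤ Real.exp 1 := by linarith [Real.exp_one_gt_d9]
  -- This makes `q²` at least `144 / ε²`, enough to absorb the factor `128 / ε²` of the confidence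
  -- bound.
  have hq12 : 12 / ε ≤ q := by
    have : 12 / ε ≤ 2 * Real.exp 1 ^ 2 / ε := by gcongr; nlinarith
    exact this.trans (le_mul_of_one_le_right (by positivity) hl1)
  have hq1 : 1 ≤ q := le_trans (by rw [le_div_iff₀ hε]; linarith) hq12
  have hlogq : 0 ≤ Real.log q := Real.log_nonneg hq1
  have hlogδ : 1 ≤ Real.log (8 / δ) := by
    rw [Real.le_log_iff_exp_le (by positivity), le_div_iff₀ hδ]
    nlinarith [Real.exp_one_lt_d9]
  have hn : 128 * (d * Real.log q + Real.log (8 / δ)) ≤ n * ε ^ 2 := by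
    rw [standardSampleComplexity, div_mul_eq_mul_div, div_le_iff₀ (by positivity)] at h
    exact h
  have hdq : 0 ≤ d * Real.log q := by positivity
  refine ⟨by linarith, ?_⟩
  have hexp : Real.exp (-(n * (ε ^ 2 / 64))) ≤ (q ^ 2)⁻¹ ^ d * (δ / 8) := by
    have h1 : (q ^ 2)⁻¹ ^ d * (δ / 8) = Real.exp (-(2 * (d * Real.log q) + Real.log (8 / δ))) := by
      rw [neg_add, Real.exp_add, Real.exp_neg (Real.log _), Real.exp_log (by positivity), inv_div,
        Real.exp_neg, inv_pow]
      congr 2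
      rw [← mul_assoc, mul_comm (2 : ℝ), mul_assoc, Real.exp_nat_mul, mul_comm (2 : ℝ), Real.exp_mul,
        Real.exp_log (by positivity)]
      norm_cast
    rw [h1]
    refine Real.exp_le_exp.2 (neg_le_neg ?_)
    linarith
  have hbase : 128 / ε ^ 2 * (q ^ 2)⁻¹ ≤ 1 := by
    rw [← div_eq_mul_inv, div_le_one (by positivity)]
    calc 128 / ε ^ 2 ≤ (12 / ε) ^ 2 := by rw [div_pow]; gcongr; norm_num
      _ ≤ q ^ 2 := by gcongr
  calc confidenceBound d ε n
      ≤ 4 * (128 / ε ^ 2) ^ d * ((q ^ 2)⁻¹ ^ d * (δ / 8)) := by unfold confidenceBound; gcongr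
    _ = (128 / ε ^ 2 * (q ^ 2)⁻¹) ^ d * (δ / 2) := by
        rw [mul_pow (128 / ε ^ 2)]
        generalize 128 / ε ^ 2 = x
        generalize (q ^ 2)⁻¹ = y
        ring
    _ ≤ 1 * (δ / 2) := by
        gcongr
        exact pow_le_one₀ (by positivity) hbase
    _ ≤ δ := by linarith

lemma measure_sampleDeviation_le_confidenceBound {Ω : Type*} [MeasurableSpace Ω]
    {𝒟 : Set (Set Ω)} (h𝒟 : 𝒟.Countable) (hmeas : ∀ D ∈ 𝒟, MeasurableSet D) (μ : Measure Ω)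
    [IsProbabilityMeasure μ] {N : Set Ω} (hN0 : μ N = 0) {d : ℕ}
    (hN : ∀ x : Fin (d + 1) → Ω, (∀ i, x i ∉ N) → ¬ ShattersTuple 𝒟 x)
    {n : ℕ} {ε : ℝ} (hε : 0 < ε) (hε1 : ε ≤ 1) (hn : 8 ≤ n * ε ^ 2) :
    Measure.pi (fun _ : Fin n => μ) (sampleDeviation 𝒟 μ n (ε / 2)) ≤
      ENNReal.ofReal (confidenceBound d ε n) := by
  -- With `t = ε / 2`, this `a` makes the growth exponent `2 n a` half of the Hoeffding exponent `n
  -- t² / 8`, leaving `-n ε² / 64`.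
  refine (measure_sampleDeviation_le h𝒟 hmeas μ hN0 hN (half_pos hε) (by linarith)
    (a := ε ^ 2 / 128) (by positivity) (by nlinarith)).trans_eq ?_
  rw [confidenceBound, inv_div]
  congr 3
  ring

/-! ### Reduction to the countable subclass and conclusion -/

/-- The supremum need not be attained; lowering the threshold to `s < t` yields a strict deviation
at some `C`, which survives along an approximating sequence. -/
lemma deviationEvent_subset {Ω : Type*} [MeasurableSpace Ω] {𝒞 𝒟 : Set (Set Ω)}
    (hmeas : ∀ C ∈ 𝒞, MeasurableSet C) (hsub : 𝒟 ⊆ 𝒞)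
    (hlim : ∀ C ∈ 𝒞, ∃ D : ℕ → Set Ω, (∀ k, D k ∈ 𝒟) ∧ ∀ x, ∃ N, ∀ k ≥ N, (x ∈ D k ↔ x ∈ C))
    (μ : ProbabilityMeasure Ω) (n : ℕ) {s t : ℝ} (ht : 0 < t) (hst : s < t) :
    deviationEvent 𝒞 μ n t ⊆ sampleDeviation 𝒟 μ n s := by
  intro σ hσ
  have h := ((ENNReal.ofReal_lt_ofReal_iff ht).2 hst).trans_le hσ
  simp only [lt_iSup_iff] at h
  obtain ⟨C, hC, hlt⟩ := h
  exact exists_deviation_lt_of_pointwise_limit (fun D hD => hmeas D (hsub hD)) _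
    (hlim C hC) (lt_of_not_ge fun hle => hlt.not_ge (ENNReal.ofReal_le_ofReal hle))

lemma measurableSet_deviationEvent {Ω : Type*} [MeasurableSpace Ω] {𝒞 𝒟 : Set (Set Ω)}
    (hmeas : ∀ C ∈ 𝒞, MeasurableSet C) (hsub : 𝒟 ⊆ 𝒞) (h𝒟 : 𝒟.Countable)
    (hlim : ∀ C ∈ 𝒞, ∃ D : ℕ → Set Ω, (∀ k, D k ∈ 𝒟) ∧ ∀ x, ∃ N, ∀ k ≥ N, (x ∈ D k ↔ x ∈ C))
    (μ : ProbabilityMeasure Ω) (n : ℕ) (ε : ℝ) : MeasurableSet (deviationEvent 𝒞 μ n ε) := by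
  -- For each fixed sample the supremum is already reached along `𝒟`, hence is a countable supremum
  -- of measurable functions.
  have heq (σ : Fin n → Ω) :
      ⨆ C ∈ 𝒞, ENNReal.ofReal |(μ : Measure Ω).real C - empiricalFreq σ C| =
      ⨆ D ∈ 𝒟, ENNReal.ofReal |(μ : Measure Ω).real D - empiricalFreq σ D| := by
    refine le_antisymm (iSup₂_le fun C hC => ?_) (biSup_mono fun D hD => hsub hD)
    obtain ⟨D, hD, hDC⟩ := hlim C hC
    exact le_of_tendsto' (ENNReal.tendsto_ofReal (tendsto_abs_measureReal_sub_empiricalFreq _ σ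
      (fun k => hmeas _ (hsub (hD k))) hDC))
      fun k => le_iSup₂_of_le (D k) (hD k) le_rfl
  simp only [deviationEvent, heq]
  exact measurableSet_le measurable_const (Measurable.biSup 𝒟 h𝒟 fun D hD =>
    ((measurable_empiricalFreq (hmeas D (hsub hD))).const_sub _).abs.ennreal_ofReal)

/-- A sample on which a consistent rule errs by at least `ε` exhibits a deviation in the class of
symmetric differences with the target. -/
lemma error_event_subset {Ω : Type*} [MeasurableSpace Ω] {𝒞 𝒟 : Set (Set Ω)}
    {P : Set (ProbabilityMeasure Ω)} (hmeas : ∀ C ∈ 𝒞, MeasurableSet C) (hsub : 𝒟 ⊆ 𝒞)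
    (hlim : ∀ C ∈ 𝒞, ∃ D : ℕ → Set Ω, (∀ k, D k ∈ 𝒟) ∧ ∀ x, ∃ N, ∀ k ≥ N, (x ∈ D k ↔ x ∈ C))
    (L : LearningRule 𝒞 P) (hL : L.Consistent) (μ : ProbabilityMeasure Ω) {C : Set Ω} (hC : C ∈ 𝒞)
    {n : ℕ} (hn : 1 ≤ n) {s t : ℝ} (hst : s < t) :
    {σ : Fin n → Ω | ENNReal.ofReal t ≤ L.error μ C σ} ⊆
      sampleDeviation ((· ∆ C) '' 𝒟) μ n s := by
  intro σ hσ
  set H := L.hyp n σ (sampleLabels C σ)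
  have hH : H ∈ 𝒞 := L.hyp_mem n hn _ _
  obtain ⟨D, hD, hDH⟩ := hlim H hH
  have hfreq : empiricalFreq σ (H ∆ C) = 0 := by
    have h (i : Fin n) : σ i ∈ H ↔ σ i ∈ C := hL C hC n hn σ i
    simp [empiricalFreq, Set.mem_symmDiff, h]
  refine exists_deviation_lt_of_pointwise_limit (C := H ∆ C) ?_ _
    ⟨fun k => D k ∆ C, fun k => Set.mem_image_of_mem _ (hD k), fun x => ?_⟩ ?_
  · rintro _ ⟨D, hD, rfl⟩
    exact (hmeas D (hsub hD)).symmDiff (hmeas C hC)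
  · obtain ⟨N, hN⟩ := hDH x
    exact ⟨N, fun k hk => by simp [Set.mem_symmDiff, hN k hk]⟩
  · rw [hfreq, sub_zero, abs_of_nonneg measureReal_nonneg]
    exact hst.trans_le ((ENNReal.ofReal_le_iff_le_toReal (measure_ne_top _ _)).1 hσ)

lemma tendsto_zero_of_le_confidenceBound {f : ℕ → ℝ≥0∞} {d : ℕ} {ε : ℝ} (hε : 0 < ε)
    (h : ∀ n : ℕ, 8 ≤ n * ε ^ 2 → f n ≤ ENNReal.ofReal (confidenceBound d ε n)) :
    Tendsto f atTop (𝓝 0) := by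
  have h1 : Tendsto (fun n => ENNReal.ofReal (confidenceBound d ε n)) atTop (𝓝 0) := by
    simpa using ENNReal.tendsto_ofReal (tendsto_confidenceBound d hε)
  have h2 : ∀ᶠ n : ℕ in atTop, 8 ≤ n * ε ^ 2 :=
    (tendsto_natCast_atTop_atTop.atTop_mul_const (by positivity)).eventually_ge_atTop 8
  exact tendsto_of_tendsto_of_tendsto_of_le_of_le' tendsto_const_nhds h1
    (Eventually.of_forall fun _ => zero_le) (h2.mono h)

theorem mainTheorem6 {Ω : Type*} [MeasurableSpace Ω] [StandardBorelSpace Ω]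
    (𝒞 : Set (Set Ω)) (hmeas : ∀ C ∈ 𝒞, MeasurableSet C)
    (hsep : UniversallySeparable 𝒞)
    (d : ℕ) (hd : vcDimModCountable 𝒞 = (d : ℕ∞)) :
    UniformGlivenkoCantelli 𝒞 (nonatomicMeasures Ω) ∧
    ConsistentlyLearnable 𝒞 (nonatomicMeasures Ω) ∧
    ∀ L : LearningRule 𝒞 (nonatomicMeasures Ω), L.Consistent →
      L.HasSampleComplexity (standardSampleComplexity d) := by
  obtain ⟨𝒟, hsub, h𝒟, hlim⟩ := hsep
  obtain ⟨N, hNc, hN⟩ :=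
    exists_countable_forall_not_shattersTuple_of_vcDimModCountable hsub h𝒟 hd.le
  have hnull (μ : ProbabilityMeasure Ω) (hμ : μ ∈ nonatomicMeasures Ω) : (μ : Measure Ω) N = 0 :=
    measure_eq_zero_of_countable_of_mem_nonatomicMeasures hμ hNc
  have hlearn (L : LearningRule 𝒞 (nonatomicMeasures Ω)) (hL : L.Consistent) {ε : ℝ} (hε : 0 < ε)
      (hε1 : ε ≤ 1) (n : ℕ) (hn : 8 ≤ n * ε ^ 2) (μ) (hμ : μ ∈ nonatomicMeasures Ω) (C) (hC : C ∈ 𝒞) :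
      sampleLaw μ n {σ | ENNReal.ofReal ε ≤ L.error μ C σ} ≤
        ENNReal.ofReal (confidenceBound d ε n) := by
    have hn1 : 1 ≤ n := by
      rcases Nat.eq_zero_or_pos n with rfl | h
      · norm_num at hn
      · exact h
    refine (measure_mono (error_event_subset hmeas hsub hlim L hL μ hC hn1
      (half_lt_self hε))).trans (measure_sampleDeviation_le_confidenceBound (h𝒟.image _) ?_ _
        (hnull μ hμ) (fun x hx h => hN x hx h.of_symmDiff) hε hε1 hn)
    rintro _ ⟨D, hD, rfl⟩
    exact (hmeas D (hsub hD)).symmDiff (hmeas C hC)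
  refine ⟨fun ε hε => ⟨fun μ _ n =>
    (measurableSet_deviationEvent hmeas hsub h𝒟 hlim μ n ε).nullMeasurableSet, ?_⟩,
    fun L hL ε hε => ?_, fun L hL ε δ hε hε1 hδ hδ1 n _ hs μ hμ C hC => ?_⟩
  · have hη : 0 < min ε 1 := lt_min hε one_pos
    refine tendsto_zero_of_le_confidenceBound (d := d) hη fun n hn => iSup₂_le fun μ hμ => ?_
    exact (measure_mono (deviationEvent_subset hmeas hsub hlim μ n hε
      ((half_lt_self hη).trans_le (min_le_left _ _)))).trans
      (measure_sampleDeviation_le_confidenceBound h𝒟 (fun D hD => hmeas D (hsub hD)) _ (hnull μ hμ)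
        hN hη (min_le_right _ _) hn)
  · have hη : 0 < min ε 1 := lt_min hε one_pos
    refine tendsto_zero_of_le_confidenceBound (d := d) hη fun n hn =>
      iSup₂_le fun μ hμ => iSup₂_le fun C hC => ?_
    refine (measure_mono fun σ hσ => ?_).trans (hlearn L hL hη (min_le_right _ _) n hn μ hμ C hC)
    exact (ENNReal.ofReal_le_ofReal (min_le_left _ _)).trans (le_of_lt hσ)
  · obtain ⟨hn, hle⟩ := eight_le_and_confidenceBound_le hε hε1 hδ hδ1 hs
    exact (hlearn L hL hε hε1 n hn μ hμ C hC).trans (ENNReal.ofReal_le_ofReal hle)
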